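/- Let $X_1,X_2,\dots$ be i.i.d. real random variables with distribution function $F$ whose right endpoint $x^F:=\sup\{x: F(x)<1\}$ is finite, and let $U(t):=\inf\{x: 1/(1-F(x))\ge t\}$, $t>1$ (with $1/0=\infty$), be the tail quantile function, so that $U(\infty):=\lim_{t\to\infty}U(t)=x^F$. Suppose that there is a slowly varying function $a$ (that is, $a$ is measurable on $(0,\infty)$, eventually positive, and $a(tx)/a(t)\to1$ as $t\to\infty$ for every $x>0$) such that $\int_t^\infty a(s)\,\frac{ds}{s}<\infty$ for all large $t$ and $$U(\infty)-U(t)=\int_t^\infty a(s)\,\frac{ds}{s}+o\bigl(a(t)\bigr),\qquad t\to\infty .$$ Let $k=k(n)$ be a sequence of positive integers with $k(n)\to\infty$ and $k(n)/n\to0$ as $n\to\infty$. Let $X_{1,n}\le\dots\le X_{n,n}$ be the order statistics of $X_1,\dots,X_n$ and, for $2k\le n$ (which holds for all large $n$), put $$\hat q\Bigl(\frac nk\Bigr):=-\frac1{\log2}\int_0^1\bigl(X_{n-[2ks],n}-X_{n-[ks],n}\bigr)\,\frac{ds}{s},\qquad \hat x^F:=X_{n-k,n}+\hat q\Bigl(\frac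 nk\Bigr),$$ where $[y]$ denotes the integer part of $y$. Then $\hat x^F$ is a consistent estimator of $x^F$: $$\hat x^F\xrightarrow{\;P\;}x^F\qquad(n\to\infty).$$ -/

import Mathlib

open Filter MeasureTheory ProbabilityTheory Asymptotics
open scoped Topology

noncomputable section

/-- The order statistic `X_{j,n}`: the `j`-th smallest (`1 ≤ j ≤ n`) of the first `n` terms
`x 0, …, x (n - 1)` of `x`. Indices outside `1, …, n` get the value `0`. -/
def orderStat (n : ℕ) (x : ℕ → ℝ) (j : ℕ) : ℝ :=
  if h : 1 ≤ j ∧ j ≤ n then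
    (fun i : Fin n => x i) (Tuple.sort (fun i : Fin n => x i) ⟨j - 1, by omega⟩)
  else 0

/-- The right endpoint `x^F = sup {x : F x < 1}` of a distribution function
(meaningful when that set is bounded above). -/
def rightEndpoint (F : ℝ → ℝ) : ℝ := sSup {x | F x < 1}

/-- The tail quantile function `U(t) = inf {x : 1 / (1 - F x) ≥ t}`, `t > 1`. The inequality is
written `1 - 1 / t ≤ F x`, so that a point with `F x = 1` counts as `1 / (1 - F x) = ∞`. -/
def tailQuantile (F : ℝ → ℝ) (t : ℝ) : ℝ := sInf {x | 1 - 1 / t ≤ F x}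

/-- Slow variation at infinity: Lebesgue measurable on `(0, ∞)`, eventually positive, and
`a (t x) / a t → 1` as `t → ∞` for every `x > 0`. -/
structure IsSlowlyVarying (a : ℝ → ℝ) : Prop where
  aemeasurable : AEMeasurable a (volume.restrict (Set.Ioi 0))
  eventually_pos : ∀ᶠ t in atTop, 0 < a t
  tendsto_ratio : ∀ x : ℝ, 0 < x → Tendsto (fun t => a (t * x) / a t) atTop (𝓝 1)

/-- The tail condition
`U(∞) - U(t) = ∫_t^∞ a(s) ds/s + o(a(t))`, `t → ∞`,
with a slowly varying `a` such that the integral converges (for large `t`). For a distribution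
function with finite right endpoint, `U(∞) = lim U(t)` is that endpoint. -/
structure SatisfiesTailCondition (F a : ℝ → ℝ) : Prop where
  slowlyVarying : IsSlowlyVarying a
  integrable : ∀ᶠ t in atTop, IntegrableOn (fun s => a s / s) (Set.Ioi t)
  isLittleO : (fun t => (rightEndpoint F - tailQuantile F t) - ∫ s in Set.Ioi t, a s / s)
    =o[atTop] a

/-- The statistic
`q̂(n/k) = -(1 / log 2) ∫_0^1 (X_{n-[2ks],n} - X_{n-[ks],n}) ds/s`. -/
def qHat (n k : ℕ) (x : ℕ → ℝ) : ℝ :=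
  -(1 / Real.log 2) * ∫ s in (0 : ℝ)..1,
    (orderStat n x (n - ⌊2 * (k : ℝ) * s⌋₊) - orderStat n x (n - ⌊(k : ℝ) * s⌋₊)) / s

/-- The endpoint estimator `x̂^F = X_{n-k,n} + q̂(n/k)`. -/
def endpointEstimator (n k : ℕ) (x : ℕ → ℝ) : ℝ :=
  orderStat n x (n - k) + qHat n k x

end

/-! The proof is a deterministic sandwich plus the law of large numbers. Since `ds/s` is invariant
under dilation and `X_{n-[ks],n}` equals `X_{n,n}` for `s` near `0`, the Frullani identity gives `q̂
= X_{n,n} - (1/log 2) ∫_1^2 X_{n-[ks],n} ds/s`. The subtracted term is a weighted mean of order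
statistics between `X_{n-2k,n}` and `X_{n-k,n}`, which yields `endpointEstimator_mem_Icc`. If more
than `2k` observations exceed `c = x^F - ε`, all these order statistics lie in `(c, x^F]`, so the
error is below `ε` (`dist_endpointEstimator_lt`). The exceedance frequency tends to `1 - F c > 0`
while `2k/n → 0`, so this has probability tending to `1`. -/

theorem orderStat_mono {n : ℕ} (x : ℕ → ℝ) {i j : ℕ} (hi : 1 ≤ i) (hij : i ≤ j) (hj : j ≤ n) :
    orderStat n x i ≤ orderStat n x j := by
  unfold orderStat
  rw [dif_pos ⟨hi, hij.trans hj⟩, dif_pos ⟨hi.trans hij, hj⟩]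
  refine Tuple.monotone_sort (fun i : Fin n => x i) ?_
  simp only [Fin.mk_le_mk]
  omega

theorem orderStat_le_of_forall_le {n : ℕ} {x : ℕ → ℝ} {b : ℝ} (hx : ∀ i, x i ≤ b) {j : ℕ}
    (hj : 1 ≤ j) (hjn : j ≤ n) : orderStat n x j ≤ b := by
  unfold orderStat
  rw [dif_pos ⟨hj, hjn⟩]
  exact hx _

/-- If more than `n - j` of the first `n` terms exceed `c`, then so does the `j`-th smallest. -/
theorem lt_orderStat_of_lt_card {n : ℕ} {x : ℕ → ℝ} {c : ℝ} {j : ℕ} (hj : 1 ≤ j) (hjn : j ≤ n)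
    (h : n - j < ((Finset.range n).filter fun i => c < x i).card) : c < orderStat n x j := by
  by_contra! hle
  refine h.not_ge ?_
  unfold orderStat at hle
  rw [dif_pos ⟨hj, hjn⟩] at hle
  set σ := Tuple.sort (fun i : Fin n => x i) with hσ
  have hcard : (Finset.Ico j n).card = n - j := Nat.card_Ico j n
  rw [← hcard]
  -- Sorted positions are 0-based: `X_{j,n}` sits at `j - 1`, so exceedances of `c` can only sit at
  -- positions in `Ico j n`.
  refine Finset.card_le_card_of_surjOn (fun m => if hm : m < n then (σ ⟨m, hm⟩ : ℕ) else 0) ?_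
  intro i hi
  simp only [Finset.coe_filter, Finset.mem_range, Set.mem_ofPred_eq] at hi
  obtain ⟨hin, hci⟩ := hi
  refine ⟨σ.symm ⟨i, hin⟩, ?_, by simp⟩
  simp only [Finset.coe_Ico, Set.mem_Ico, Fin.is_lt, and_true]
  by_contra! hlt
  have hm := Tuple.monotone_sort (fun i : Fin n => x i)
    (show σ.symm ⟨i, hin⟩ ≤ ⟨j - 1, by omega⟩ by rw [Fin.le_def]; simp only; omega)
  rw [← hσ] at hm
  simp only [Function.comp_apply, Equiv.apply_symm_apply] at hm
  exact absurd (hci.trans_le (hm.trans hle)) (lt_irrefl c)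

theorem AntitoneOn.intervalIntegrable_div {g : ℝ → ℝ} {b p q : ℝ} (hg : AntitoneOn g (Set.Icc 0 b))
    (hp : 0 < p) (hpq : p ≤ q) (hq : q ≤ b) :
    IntervalIntegrable (fun s => g s / s) volume p q := by
  have h₁ : IntervalIntegrable g volume p q := by
    refine (hg.mono ?_).intervalIntegrable
    rw [Set.uIcc_of_le hpq]
    exact Set.Icc_subset_Icc hp.le hq
  simp_rw [div_eq_mul_inv]
  refine h₁.mul_continuousOn (continuousOn_inv₀.mono ?_)
  rw [Set.uIcc_of_le hpq]
  intro s hs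
  exact (hp.trans_le hs.1).ne'

/-- A Frullani-type identity for a function that is constant near `0`. -/
theorem AntitoneOn.integral_frullani_two {g : ℝ → ℝ} {M δ : ℝ} (hg : AntitoneOn g (Set.Icc 0 2))
    (hδ : 0 < δ) (hδ1 : 2 * δ ≤ 1) (hM : ∀ s ∈ Set.Icc 0 (2 * δ), g s = M) :
    ∫ s in (0 : ℝ)..1, (g (2 * s) - g s) / s =
      (∫ s in (1 : ℝ)..2, g s / s) - M * Real.log 2 := by
  have hzero : Set.EqOn (fun s => (g (2 * s) - g s) / s) (fun _ => (0 : ℝ)) (Set.uIcc 0 δ) := by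
    intro s hs
    rw [Set.uIcc_of_le hδ.le] at hs
    simp only
    rw [hM (2 * s) ⟨by linarith [hs.1], by linarith [hs.2]⟩,
      hM s ⟨hs.1, by linarith [hs.2]⟩, sub_self, zero_div]
  have hdil : IntervalIntegrable (fun s => g (2 * s) / s) volume δ 1 := by
    have hg2 : AntitoneOn (fun s => g (2 * s)) (Set.Icc 0 1) := by
      intro s hs t ht hst
      exact hg ⟨by linarith [hs.1], by linarith [hs.2]⟩ ⟨by linarith [ht.1], by linarith [ht.2]⟩
        (by linarith)
    exact hg2.intervalIntegrable_div hδ (by linarith) le_rfl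
  have hg1 : IntervalIntegrable (fun s => g s / s) volume δ 1 :=
    hg.intervalIntegrable_div hδ (by linarith) (by norm_num)
  have hI₀ : IntervalIntegrable (fun s => (g (2 * s) - g s) / s) volume 0 δ := by
    refine (intervalIntegrable_const (c := (0 : ℝ))).congr ?_
    intro s hs
    exact (hzero (Set.uIoc_subset_uIcc hs)).symm
  have hI₁ : IntervalIntegrable (fun s => (g (2 * s) - g s) / s) volume δ 1 := by
    simp_rw [sub_div]
    exact hdil.sub hg1
  -- Dilation invariance of `ds/s`, with `u = 2s`.
  have hsubst : ∫ s in δ..1, g (2 * s) / s = ∫ s in (2 * δ)..2, g s / s := by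
    have h := intervalIntegral.integral_comp_mul_left (a := δ) (b := 1)
      (fun u => g u / u) (two_ne_zero (α := ℝ))
    rw [mul_one, smul_eq_mul, eq_inv_mul_iff_mul_eq₀ two_ne_zero,
      ← intervalIntegral.integral_const_mul] at h
    rw [← h]
    refine intervalIntegral.integral_congr fun s _ => ?_
    rw [← mul_div_assoc, mul_div_mul_left _ _ two_ne_zero]
  have hnear : ∫ s in δ..(2 * δ), g s / s = M * Real.log 2 := by
    have : ∫ s in δ..(2 * δ), g s / s = ∫ s in δ..(2 * δ), M * s⁻¹ := by
      refine intervalIntegral.integral_congr fun s hs => ?_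
      rw [Set.uIcc_of_le (by linarith)] at hs
      rw [hM s ⟨by linarith [hs.1], hs.2⟩, div_eq_mul_inv]
    rw [this, intervalIntegral.integral_const_mul, integral_inv_of_pos hδ (by linarith),
      mul_div_cancel_right₀ _ hδ.ne']
  have hA : IntervalIntegrable (fun s => g s / s) volume δ (2 * δ) :=
    hg.intervalIntegrable_div hδ (by linarith) (by linarith)
  have hB : IntervalIntegrable (fun s => g s / s) volume (2 * δ) 1 :=
    hg.intervalIntegrable_div (by linarith) hδ1 (by norm_num)
  have hC : IntervalIntegrable (fun s => g s / s) volume 1 2 :=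
    hg.intervalIntegrable_div one_pos (by norm_num) le_rfl
  rw [← intervalIntegral.integral_add_adjacent_intervals hI₀ hI₁,
    intervalIntegral.integral_congr hzero, intervalIntegral.integral_zero, zero_add]
  simp_rw [sub_div]
  rw [intervalIntegral.integral_sub hdil hg1, hsubst,
    ← intervalIntegral.integral_add_adjacent_intervals hB hC,
    ← intervalIntegral.integral_add_adjacent_intervals hA hB, hnear]
  ring

/-- The measure `ds/s` has mass `log 2` on `[1, 2]`. -/
theorem AntitoneOn.integral_div_mem_Icc {g : ℝ → ℝ} (hg : AntitoneOn g (Set.Icc 0 2)) :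
    ∫ s in (1 : ℝ)..2, g s / s ∈ Set.Icc (g 2 * Real.log 2) (g 1 * Real.log 2) := by
  have hC : IntervalIntegrable (fun s => g s / s) volume 1 2 :=
    hg.intervalIntegrable_div one_pos (by norm_num) le_rfl
  have hconst (M : ℝ) : ∫ s in (1 : ℝ)..2, M / s = M * Real.log 2 := by
    simp_rw [div_eq_mul_inv]
    rw [intervalIntegral.integral_const_mul, integral_inv_of_pos one_pos two_pos, div_one]
  have hi (M : ℝ) : IntervalIntegrable (fun s => M / s) volume 1 2 :=
    (antitoneOn_const (s := Set.Icc (0 : ℝ) 2)).intervalIntegrable_div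
      one_pos (by norm_num) le_rfl
  rw [← hconst, ← hconst]
  constructor
  · refine intervalIntegral.integral_mono_on (by norm_num) (hi _) hC fun s hs => ?_
    exact div_le_div_of_nonneg_right
      (hg ⟨by linarith [hs.1], hs.2⟩ ⟨by norm_num, le_rfl⟩ hs.2) (by linarith [hs.1])
  · refine intervalIntegral.integral_mono_on (by norm_num) hC (hi _) fun s hs => ?_
    exact div_le_div_of_nonneg_right
      (hg ⟨by norm_num, by norm_num⟩ ⟨by linarith [hs.1], hs.2⟩ hs.1) (by linarith [hs.1])

/-- The endpoint estimator lies between the sample maximum `X_{n,n}` and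
`X_{n,n} + X_{n-k,n} - X_{n-2k,n}`. -/
theorem endpointEstimator_mem_Icc {n k : ℕ} (hk : 0 < k) (hkn : 2 * k < n) (x : ℕ → ℝ) :
    endpointEstimator n k x ∈ Set.Icc (orderStat n x n)
      (orderStat n x n + (orderStat n x (n - k) - orderStat n x (n - 2 * k))) := by
  have hk' : (0 : ℝ) < k := Nat.cast_pos.mpr hk
  have hk1 : (1 : ℝ) ≤ k := Nat.one_le_cast.mpr hk
  set g : ℝ → ℝ := fun s => orderStat n x (n - ⌊(k : ℝ) * s⌋₊) with hgdef
  have hg : AntitoneOn g (Set.Icc 0 2) := by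
    intro s _ t ht hst
    have h2 : ⌊(k : ℝ) * t⌋₊ ≤ 2 * k := by
      refine Nat.floor_le_of_le ?_
      push_cast
      nlinarith [ht.2]
    have h3 : ⌊(k : ℝ) * s⌋₊ ≤ ⌊(k : ℝ) * t⌋₊ :=
      Nat.floor_le_floor (mul_le_mul_of_nonneg_left hst hk'.le)
    exact orderStat_mono x (by omega) (by omega) (Nat.sub_le _ _)
  -- The choice `δ = 1/(4k)` keeps `k * s ≤ 1/2` on `[0, 2δ]`, so the floor vanishes there.
  have hM : ∀ s ∈ Set.Icc (0 : ℝ) (2 * (1 / (4 * k))), g s = orderStat n x n := by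
    intro s hs
    have h0 : ⌊(k : ℝ) * s⌋₊ = 0 := by
      rw [Nat.floor_eq_zero]
      calc (k : ℝ) * s ≤ k * (2 * (1 / (4 * k))) := mul_le_mul_of_nonneg_left hs.2 hk'.le
        _ = 1 / 2 := by field_simp; norm_num
        _ < 1 := by norm_num
    simp only [hgdef, h0, Nat.sub_zero]
  have hδ : 2 * (1 / (4 * (k : ℝ))) ≤ 1 := by
    rw [mul_one_div, div_le_one (by positivity)]
    linarith
  have hint := hg.integral_frullani_two (by positivity) hδ hM
  have hmem := hg.integral_div_mem_Icc
  have hg1 : g 1 = orderStat n x (n - k) := by simp [hgdef]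
  have hg2 : g 2 = orderStat n x (n - 2 * k) := by
    have : ⌊(k : ℝ) * 2⌋₊ = 2 * k := by
      rw [show (k : ℝ) * 2 = ((2 * k : ℕ) : ℝ) by push_cast; ring, Nat.floor_natCast]
    simp only [hgdef, this]
  rw [hg1, hg2] at hmem
  have hlog : 0 < Real.log 2 := Real.log_pos one_lt_two
  have hq : qHat n k x = orderStat n x n - (∫ s in (1 : ℝ)..2, g s / s) / Real.log 2 := by
    have heq : qHat n k x
        = -(1 / Real.log 2) * ∫ s in (0 : ℝ)..1, (g (2 * s) - g s) / s := by
      unfold qHat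
      congr 1
      refine intervalIntegral.integral_congr fun s _ => ?_
      simp only [hgdef]
      rw [show (k : ℝ) * (2 * s) = 2 * k * s by ring]
    rw [heq, hint]
    field_simp
    ring
  have hlo := (le_div_iff₀ hlog).mpr hmem.1
  have hhi := (div_le_iff₀ hlog).mpr hmem.2
  unfold endpointEstimator
  rw [hq]
  constructor <;> linarith

/-- If more than `2k` of the first `n` terms exceed `c` and no term exceeds `b`, then the endpoint
estimator is within `b - c` of `b`. -/
theorem dist_endpointEstimator_lt {n k : ℕ} (hk : 0 < k) (hkn : 2 * k < n) {x : ℕ → ℝ} {b c : ℝ}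
    (hx : ∀ i, x i ≤ b) (hc : 2 * k < ((Finset.range n).filter fun i => c < x i).card) :
    dist (endpointEstimator n k x) b < b - c := by
  obtain ⟨hlo, hhi⟩ := endpointEstimator_mem_Icc hk hkn x
  have h2k : c < orderStat n x (n - 2 * k) :=
    lt_orderStat_of_lt_card (by omega) (Nat.sub_le _ _) (by omega)
  have hmax : orderStat n x (n - 2 * k) ≤ orderStat n x n :=
    orderStat_mono x (by omega) (Nat.sub_le _ _) le_rfl
  have hub : orderStat n x n ≤ b := orderStat_le_of_forall_le hx (by omega) le_rfl
  have hkb : orderStat n x (n - k) ≤ b :=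
    orderStat_le_of_forall_le hx (by omega) (Nat.sub_le _ _)
  rw [Real.dist_eq, abs_lt]
  -- Above: `X_{n,n}` and `X_{n-k,n}` are at most `b` and `X_{n-2k,n} > c`. Below: `X_{n,n} > c`.
  constructor <;> linarith

theorem identDistrib_of_measureReal_le_eq {Ω : Type*} [MeasurableSpace Ω] {μ : Measure Ω}
    [IsProbabilityMeasure μ] {Y Z : Ω → ℝ} (hY : AEMeasurable Y μ) (hZ : AEMeasurable Z μ)
    (h : ∀ x, μ.real {ω | Y ω ≤ x} = μ.real {ω | Z ω ≤ x}) : IdentDistrib Y Z μ μ := by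
  refine ⟨hY, hZ, ?_⟩
  have := Measure.isProbabilityMeasure_map hY
  have := Measure.isProbabilityMeasure_map hZ
  refine Measure.ext_of_Iic _ _ fun x => ?_
  rw [Measure.map_apply_of_aemeasurable hY measurableSet_Iic,
    Measure.map_apply_of_aemeasurable hZ measurableSet_Iic]
  exact (measureReal_eq_measureReal_iff).mp (h x)

/-- The empirical frequencies of exceedances over `c` converge in probability. -/
theorem tendstoInMeasure_exceedance_frequency {Ω : Type*} [MeasurableSpace Ω] (μ : Measure Ω)
    [IsProbabilityMeasure μ] (X : ℕ → Ω → ℝ) (hX : ∀ i, AEMeasurable (X i) μ)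
    (hindep : iIndepFun X μ) (hident : ∀ i, IdentDistrib (X i) (X 0) μ μ) (c : ℝ) :
    TendstoInMeasure μ
      (fun (n : ℕ) ω => (((Finset.range n).filter fun i => c < X i ω).card : ℝ) / n) atTop
      (fun _ => 1 - μ.real {ω | X 0 ω ≤ c}) := by
  set φ : ℝ → ℝ := (Set.Ioi c).indicator 1 with hφ
  have hφm : Measurable φ := measurable_one.indicator measurableSet_Ioi
  have hYm (i : ℕ) : AEMeasurable (φ ∘ X i) μ := hφm.comp_aemeasurable (hX i)
  have hint : Integrable (φ ∘ X 0) μ := by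
    refine Integrable.of_bound (hYm 0).aestronglyMeasurable 1 (ae_of_all _ fun ω => ?_)
    simp only [hφ, Function.comp_apply, Set.indicator_apply]
    split_ifs <;> simp
  have hlln := strong_law_ae_real (fun i => φ ∘ X i) hint
    (fun i j hij => (hindep.indepFun hij).comp hφm hφm) (fun i => (hident i).comp hφm)
  have hmean : ∫ ω, (φ ∘ X 0) ω ∂μ = 1 - μ.real {ω | X 0 ω ≤ c} := by
    have hs : NullMeasurableSet {ω | X 0 ω ≤ c} μ :=
      (hX 0).nullMeasurableSet_preimage measurableSet_Iic
    have : (φ ∘ X 0) = {ω | X 0 ω ≤ c}ᶜ.indicator 1 := by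
      ext ω
      simp [hφ, Set.indicator_apply]
    rw [this, integral_indicator₀ hs.compl]
    simp [probReal_compl_eq_one_sub₀ hs]
  have hsum (n : ℕ) (ω : Ω) : (((Finset.range n).filter fun i => c < X i ω).card : ℝ)
      = ∑ i ∈ Finset.range n, (φ ∘ X i) ω := by
    simp [hφ, Set.indicator_apply]
  simp_rw [hsum]
  refine tendstoInMeasure_of_tendsto_ae (fun n => ?_) ?_
  · exact ((Finset.aemeasurable_fun_sum _ fun i _ => hYm i).div_const _).aestronglyMeasurable
  · rw [← hmean]
    exact hlln

theorem theorem4p1 {Ω : Type*} [MeasurableSpace Ω] (μ : Measure Ω) [IsProbabilityMeasure μ]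
    (X : ℕ → Ω → ℝ) (hX : ∀ i, AEMeasurable (X i) μ) (hindep : iIndepFun X μ)
    (F : ℝ → ℝ) (hF : ∀ i x, μ.real {ω | X i ω ≤ x} = F x)
    (hfin : BddAbove {x | F x < 1})
    (a : ℝ → ℝ) (ha : SatisfiesTailCondition F a)
    (k : ℕ → ℕ) (hkpos : ∀ n, 0 < k n) (hk : Tendsto k atTop atTop)
    (hkn : Tendsto (fun n : ℕ => (k n : ℝ) / (n : ℝ)) atTop (𝓝 0)) :
    TendstoInMeasure μ (fun n ω => endpointEstimator n (k n) (fun i => X i ω)) atTop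
      (fun _ => rightEndpoint F) := by
  have hident (i : ℕ) : IdentDistrib (X i) (X 0) μ μ :=
    identDistrib_of_measureReal_le_eq (hX i) (hX 0) fun x => by rw [hF, hF]
  have hcdf (x : ℝ) : F x = cdf (μ.map (X 0)) x := by
    have := Measure.isProbabilityMeasure_map (hX 0)
    rw [cdf_eq_real, ← hF 0 x, map_measureReal_apply_of_aemeasurable (hX 0) measurableSet_Iic]
    rfl
  have hmono : Monotone F := by
    intro x y hxy
    rw [hcdf, hcdf]
    exact monotone_cdf _ hxy
  have hne : {x | F x < 1}.Nonempty := by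
    have h := (tendsto_cdf_atBot (μ.map (X 0))).eventually_lt_const zero_lt_one
    obtain ⟨x, hx⟩ := h.exists
    exact ⟨x, by rw [Set.mem_ofPred_eq, hcdf]; exact hx⟩
  have hbound : ∀ᵐ ω ∂μ, ∀ i, X i ω ≤ rightEndpoint F := by
    rw [ae_all_iff]
    intro i
    -- `F` equals `1` to the right of the endpoint, hence also at it by right continuity.
    have hF1 : F (rightEndpoint F) = 1 := by
      have hr : Tendsto F (𝓝[>] rightEndpoint F) (𝓝 (F (rightEndpoint F))) := by
        have h := (cdf (μ.map (X 0))).right_continuous (rightEndpoint F)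
        rw [show F = cdf (μ.map (X 0)) from funext hcdf] at *
        exact h.mono_left (nhdsWithin_mono _ Set.Ioi_subset_Ici_self)
      refine tendsto_nhds_unique hr (tendsto_const_nhds.congr' ?_)
      filter_upwards [self_mem_nhdsWithin] with x hx
      refine le_antisymm (not_lt.mp fun hlt => ?_) ?_
      · exact (le_csSup hfin (show x ∈ {x | F x < 1} from hlt)).not_gt hx
      · rw [← hF 0 x]
        exact measureReal_le_one
    have hs : NullMeasurableSet {ω | X i ω ≤ rightEndpoint F} μ :=
      (hX i).nullMeasurableSet_preimage measurableSet_Iic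
    have := hF i (rightEndpoint F)
    rw [hF1] at this
    exact (prob_compl_eq_zero_iff₀ hs).mpr (by
      rw [← ofReal_measureReal, this, ENNReal.ofReal_one])
  rw [tendstoInMeasure_iff_dist]
  intro ε hε
  set c := rightEndpoint F - ε with hc
  have hFc : F c < 1 := by
    obtain ⟨y, hy, hcy⟩ := exists_lt_of_lt_csSup hne (show c < sSup {x | F x < 1} by
      change c < rightEndpoint F
      linarith)
    exact (hmono hcy.le).trans_lt hy
  have hfreq := tendstoInMeasure_exceedance_frequency μ X hX hindep hident c
  rw [hF 0 c, tendstoInMeasure_iff_dist] at hfreq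
  -- A frequency within `(1 - F c)/2` of its limit exceeds `(1 - F c)/2`, which exceeds `2k/n` once
  -- `k/n < (1 - F c)/4`. So an error of at least `ε` forces a frequency deviation of at least `(1 -
  -- F c)/2`, almost surely.
  refine tendsto_of_tendsto_of_tendsto_of_le_of_le' tendsto_const_nhds
    (hfreq ((1 - F c) / 2) (by linarith)) (Eventually.of_forall fun _ => zero_le) ?_
  have hsmall := hkn.eventually_lt_const (show 0 < (1 - F c) / 4 by linarith)
  have hhalf := hkn.eventually_lt_const (show (0 : ℝ) < 1 / 2 by norm_num)
  filter_upwards [hsmall, hhalf, eventually_gt_atTop 0] with n hn1 hn2 hn0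
  have hn0' : (0 : ℝ) < n := Nat.cast_pos.mpr hn0
  have h2k : 2 * k n < n := by
    rw [div_lt_iff₀ hn0'] at hn2
    have : (2 * k n : ℝ) < n := by linarith
    exact_mod_cast this
  refine measure_mono_ae ?_
  filter_upwards [hbound] with ω hω hmem
  by_contra hnot
  have hnot : dist _ _ < (1 - F c) / 2 := lt_of_not_ge hnot
  rw [Real.dist_eq, abs_lt] at hnot
  have hlt : (k n : ℝ) / n * 2
      < (((Finset.range n).filter fun i => c < X i ω).card : ℝ) / n := by linarith [hnot.1]
  rw [div_mul_eq_mul_div, div_lt_div_iff_of_pos_right hn0'] at hlt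
  have hcard : 2 * k n < ((Finset.range n).filter fun i => c < X i ω).card := by
    have : ((2 * k n : ℕ) : ℝ) < (((Finset.range n).filter fun i => c < X i ω).card : ℝ) := by
      push_cast
      linarith
    exact_mod_cast this
  have hd := dist_endpointEstimator_lt (hkpos n) h2k hω hcard
  have hmem : ε ≤ dist (endpointEstimator n (k n) fun i => X i ω) (rightEndpoint F) := hmem
  linarith
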